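/- For each $N\in\mathbb N$ let $(X^{(N)}_n)_{n\ge 0}$ be a discrete-time Markov chain on a finite set $\mathbb X^{(N)}$ with irreducible transition matrix $P^{(N)}$, stationary distribution $\pi^{(N)}$ and an arbitrary initial distribution. Put $$d^{(N)}(n)=\tfrac12\sum_{x\in\mathbb X^{(N)}}\bigl|\mathbb P(X^{(N)}_n=x)-\pi^{(N)}(x)\bigr| .$$ Let $A^{(N)}\subset\mathbb X^{(N)}$ be nonempty, let $T_{A^{(N)}}=\inf\{n\ge 0: X^{(N)}_n\in A^{(N)}\}$, and suppose that $A^{(N)}$ is a halting set, that is, $d^{(N)}(n)\le\mathbb P(T_{A^{(N)}}>n)$ for all $n\ge 0$. Write $t_N=\mathbb E[T_{A^{(N)}}]$, let $w_N=\sigma(T_{A^{(N)}})$ be the standard deviation of $T_{A^{(N)}}$, and let $\lambda_{A^{(N)}}$ be the largest real eigenvalue of the restriction of $P^{(N)}$ to $(\mathbb X^{(N)}\setminus A^{(N)})\times(\mathbb X^{(N)}\setminus A^{(N)})$ (with $\lambda_{A^{(N)}}=0$ if $A^{(N)}=\mathbb X^{(N)}$). Assume $w_N=o(t_N)$ as $N\to\infty$.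 1. If $(1-\lambda_{A^{(N)}})\,t_N\to\infty$ as $N\to\infty$, then the chains have a total-variation cutoff at $t_N$: $d^{(N)}(\lfloor c\,t_N\rfloor)\to 0$ for every $c>1$, and $d^{(N)}(\lfloor c\,t_N\rfloor)\to 1$ for every $0\le c<1$. 2. If furthermore $\liminf_{N\to\infty}(1-\lambda_{A^{(N)}})\,w_N>0$, then the chains have a total-variation cutoff at $t_N$ with window $w_N$: $w_N=o(t_N)$ and $$\lim_{\gamma\to+\infty}\liminf_{N\to\infty}d^{(N)}(\lfloor t_N-\gamma w_N\rfloor)=1,\qquad \lim_{\gamma\to+\infty}\limsup_{N\to\infty}d^{(N)}(\lfloor t_N+\gamma w_N\rfloor)=0 .$$ -/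

import Mathlib

open MeasureTheory ProbabilityTheory Filter Topology Asymptotics

noncomputable section

namespace HaltingCutoff

variable {S Ω : Type*} [Fintype S] [MeasurableSpace Ω]

/-- `P` is a stochastic matrix on the finite set `S` (nonnegative entries, rows of sum one). -/
def IsStochastic (P : Matrix S S ℝ) : Prop :=
  (∀ x y, 0 ≤ P x y) ∧ ∀ x, ∑ y, P x y = 1

/-- `p` is a stationary probability distribution of the transition matrix `P`. -/
def IsStationary (P : Matrix S S ℝ) (p : S → ℝ) : Prop :=
  p ∈ stdSimplex ℝ S ∧ Matrix.vecMul p P = p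

/-- `X` is a (time-homogeneous, discrete-time) Markov chain with transition matrix `P` under `μ`,
with an arbitrary initial distribution: each `X n` is a random variable with values in the discrete
space `S`, and for every path `x`,
`ℙ(X 0 = x 0, …, X (n+1) = x (n+1)) = ℙ(X 0 = x 0, …, X n = x n) * P (x n) (x (n+1))`. -/
def IsMarkovChain (P : Matrix S S ℝ) (μ : Measure Ω) (X : ℕ → Ω → S) : Prop :=
  (∀ n, Measurable[_, ⊤] (X n)) ∧
    ∀ (n : ℕ) (x : ℕ → S),
      μ.real {ω | ∀ i ≤ n + 1, X i ω = x i} =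
        μ.real {ω | ∀ i ≤ n, X i ω = x i} * P (x n) (x (n + 1))

/-- The total variation distance `d(n) = ‖π_n - π‖_TV = (1/2) ∑ x, |π_n x - π x|`, where `π_n` is
the law of `X n` under `μ` and `π = p`. -/
def tvDist (μ : Measure Ω) (X : ℕ → Ω → S) (p : S → ℝ) (n : ℕ) : ℝ :=
  (1 / 2) * ∑ x, |μ.real {ω | X n ω = x} - p x|

/-- The hitting time `T_A = inf {n ≥ 0 | X n ∈ A}`, with value `⊤` if `A` is never hit. -/
def hittingTime (X : ℕ → Ω → S) (A : Set S) : Ω → WithTop ℕ :=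
  hittingAfter X A 0

/-- `T_A` as a real random variable. (For an irreducible chain on a finite set and nonempty `A`,
`T_A` is almost surely finite, so the value given to `⊤` is irrelevant, and `T_A` has moments of
all orders.) -/
def realHittingTime (X : ℕ → Ω → S) (A : Set S) (ω : Ω) : ℝ :=
  (((hittingTime X A ω).untopD 0 : ℕ) : ℝ)

/-- The expectation of `T_A`. -/
def meanHit (μ : Measure Ω) (X : ℕ → Ω → S) (A : Set S) : ℝ :=
  ∫ ω, realHittingTime X A ω ∂μ

/-- The standard deviation `σ(T_A)`. -/
def stdHit (μ : Measure Ω) (X : ℕ → Ω → S) (A : Set S) : ℝ :=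
  √(variance (realHittingTime X A) μ)

/-- `A` is a halting set (for total variation and the chain `X`): `d(n) ≤ ℙ(T_A > n)` for all
`n ≥ 0`. -/
def IsHaltingSet (μ : Measure Ω) (X : ℕ → Ω → S) (p : S → ℝ) (A : Set S) : Prop :=
  ∀ n : ℕ, tvDist μ X p n ≤ μ.real {ω | (n : WithTop ℕ) < hittingTime X A ω}

open scoped Classical in
/-- The largest (real) eigenvalue of the restriction of `P` to `Aᶜ × Aᶜ`. The set of eigenvalues is
finite, and it is nonempty when `Aᶜ` is (Perron–Frobenius), so the supremum is a maximum; the value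
for `A = univ` is `0`. -/
def topEigenvalue (P : Matrix S S ℝ) (A : Set S) : ℝ :=
  sSup {r : ℝ | Module.End.HasEigenvalue
    (Matrix.toLin' (P.submatrix ((↑) : {x // x ∉ A} → S) ((↑) : {x // x ∉ A} → S))) r}

/-- Cutoff at `t N` for the distances `d N n`: `d N ⌊c t N⌋ → 0` if `c > 1`, and
`d N ⌊c t N⌋ → 1` if `c < 1`. -/
def HasCutoff (d : ℕ → ℕ → ℝ) (t : ℕ → ℝ) : Prop :=
  (∀ c : ℝ, 1 < c → Tendsto (fun N => d N ⌊c * t N⌋₊) atTop (𝓝 0)) ∧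
    ∀ c : ℝ, 0 ≤ c → c < 1 → Tendsto (fun N => d N ⌊c * t N⌋₊) atTop (𝓝 1)

/-- Cutoff at `t N` with window `w N`: `w = o(t)`,
`lim_{γ → ∞} liminf_N d N ⌊t N - γ w N⌋ = 1` and `lim_{γ → ∞} limsup_N d N ⌊t N + γ w N⌋ = 0`.
(As `w = o(t)`, the time `t N - γ w N` is nonnegative for all large `N` when `t N > 0`.) -/
def HasCutoffWindow (d : ℕ → ℕ → ℝ) (t w : ℕ → ℝ) : Prop :=
  w =o[atTop] t ∧
    Tendsto (fun γ : ℝ => liminf (fun N => d N ⌊t N - γ * w N⌋₊) atTop) atTop (𝓝 1) ∧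
    Tendsto (fun γ : ℝ => limsup (fun N => d N ⌊t N + γ * w N⌋₊) atTop) atTop (𝓝 0)

end HaltingCutoff

end

set_option linter.unusedSectionVars false

/-! The upper bound is Chebyshev: the halting property bounds `d(t + s)` by the tail of `T_A` beyond
`t + s`, hence by `w² / s²` (`IsHaltingSet.tvDist_le`). The lower bound rests on a smoothness
property of stationary chains. Under the stationary law the point masses of `T_A` at positive times
are nonincreasing, so a window of length `k` placed after time `a` carries mass at most `k / a`
(`stationary_hit_le`). The actual chain instead hits `A` within about `s` of `t`, up to probability
`w² / s²`. Restart at an earlier time `n`: hitting in that window is then an event depending only on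
the chain from time `n` on, very likely for the chain but unlikely under stationarity when `s` is
much smaller than `t - n`. This forces `d(n)` close to 1 (`measureReal_hit_sub_le_tvDist`,
`one_sub_le_tvDist`). The eigenvalue enters only through `λ ≥ -1`: since `1 - λ ≤ 2`, the two
spectral assumptions give `t → ∞` and `w` bounded away from 0, which makes the rounding of times
harmless. -/

namespace HaltingCutoff

/-! ### Avoidance probabilities of the transition matrix: stationary smoothness and geometric decay.
-/

section AvoidProb

variable {S : Type*} [Fintype S]

open scoped Classical in
/-- The probability that the chain with transition matrix `P` started at `x` avoids `A` at all
times `0, …, n`. -/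
noncomputable def avoidProb (P : Matrix S S ℝ) (A : Set S) : ℕ → S → ℝ
  | 0, x => if x ∈ A then 0 else 1
  | n + 1, x => if x ∈ A then 0 else ∑ y, P x y * avoidProb P A n y

variable {P : Matrix S S ℝ} {A : Set S}

lemma avoidProb_of_mem {x : S} (hx : x ∈ A) (n : ℕ) : avoidProb P A n x = 0 := by
  cases n <;> simp [avoidProb, hx]

lemma avoidProb_zero_of_notMem {x : S} (hx : x ∉ A) : avoidProb P A 0 x = 1 := by
  simp [avoidProb, hx]

lemma avoidProb_succ_of_notMem {x : S} (hx : x ∉ A) (n : ℕ) :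
    avoidProb P A (n + 1) x = ∑ y, P x y * avoidProb P A n y := by
  simp [avoidProb, hx]

lemma avoidProb_nonneg (hP : IsStochastic P) (n : ℕ) (x : S) : 0 ≤ avoidProb P A n x := by
  induction n generalizing x with
  | zero => unfold avoidProb; split_ifs <;> norm_num
  | succ n ih =>
    unfold avoidProb
    split_ifs
    · exact le_rfl
    · exact Finset.sum_nonneg fun y _ => mul_nonneg (hP.1 x y) (ih y)

lemma avoidProb_le_one (hP : IsStochastic P) (n : ℕ) (x : S) : avoidProb P A n x ≤ 1 := by
  induction n generalizing x with
  | zero => unfold avoidProb; split_ifs <;> norm_num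
  | succ n ih =>
    unfold avoidProb
    split_ifs
    · exact zero_le_one
    · calc ∑ y, P x y * avoidProb P A n y ≤ ∑ y, P x y * 1 :=
          Finset.sum_le_sum fun y _ => mul_le_mul_of_nonneg_left (ih y) (hP.1 x y)
        _ = 1 := by simp [hP.2 x]

lemma avoidProb_succ_le (hP : IsStochastic P) (n : ℕ) (x : S) :
    avoidProb P A (n + 1) x ≤ avoidProb P A n x := by
  induction n generalizing x with
  | zero =>
    by_cases hx : x ∈ A
    · simp [avoidProb_of_mem hx]
    · rw [avoidProb_zero_of_notMem hx]
      exact avoidProb_le_one hP 1 x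
  | succ n ih =>
    by_cases hx : x ∈ A
    · simp [avoidProb_of_mem hx]
    · rw [avoidProb_succ_of_notMem hx, avoidProb_succ_of_notMem hx]
      exact Finset.sum_le_sum fun y _ => mul_le_mul_of_nonneg_left (ih y) (hP.1 x y)

lemma avoidProb_antitone (hP : IsStochastic P) (x : S) :
    Antitone fun n => avoidProb P A n x :=
  antitone_nat_of_succ_le fun n => avoidProb_succ_le hP n x

/-- For the stationary chain, the probabilities `ℙ(T_A = n)`, `n ≥ 1`, are nonincreasing. -/
lemma stationary_hit_antitone (hP : IsStochastic P) {p : S → ℝ} (hp : IsStationary P p) :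
    Antitone fun n => ∑ x, p x * (avoidProb P A n x - avoidProb P A (n + 1) x) := by
  refine antitone_nat_of_succ_le fun n => ?_
  have hr : ∀ y, 0 ≤ avoidProb P A n y - avoidProb P A (n + 1) y :=
    fun y => sub_nonneg.2 (avoidProb_succ_le hP n y)
  -- One-step recursion: equality off `A`, while on `A` the left side vanishes. Averaging over `p`
  -- then removes `P` by stationarity.
  have hstep : ∀ x, avoidProb P A (n + 1) x - avoidProb P A (n + 1 + 1) x ≤
      ∑ y, P x y * (avoidProb P A n y - avoidProb P A (n + 1) y) := by
    intro x
    by_cases hx : x ∈ A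
    · rw [avoidProb_of_mem hx, avoidProb_of_mem hx, sub_zero]
      exact Finset.sum_nonneg fun y _ => mul_nonneg (hP.1 x y) (hr y)
    · rw [avoidProb_succ_of_notMem hx, avoidProb_succ_of_notMem hx, ← Finset.sum_sub_distrib]
      simp [mul_sub]
  calc ∑ x, p x * (avoidProb P A (n + 1) x - avoidProb P A (n + 1 + 1) x)
      ≤ ∑ x, p x * ∑ y, P x y * (avoidProb P A n y - avoidProb P A (n + 1) y) :=
        Finset.sum_le_sum fun x _ => mul_le_mul_of_nonneg_left (hstep x) (hp.1.1 x)
    _ = ∑ y, (∑ x, p x * P x y) * (avoidProb P A n y - avoidProb P A (n + 1) y) := by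
        simp_rw [Finset.mul_sum, Finset.sum_mul]
        rw [Finset.sum_comm]
        exact Finset.sum_congr rfl fun _ _ => Finset.sum_congr rfl fun _ _ => by ring
    _ = ∑ y, p y * (avoidProb P A n y - avoidProb P A (n + 1) y) := by
        refine Finset.sum_congr rfl fun y _ => ?_
        congr 1
        exact congrFun hp.2 y

lemma sum_stationary_avoidProb_le_one (hP : IsStochastic P) {p : S → ℝ}
    (hp : IsStationary P p) (n : ℕ) : ∑ x, p x * avoidProb P A n x ≤ 1 :=
  calc ∑ x, p x * avoidProb P A n x ≤ ∑ x, p x * 1 :=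
        Finset.sum_le_sum fun x _ => mul_le_mul_of_nonneg_left (avoidProb_le_one hP n x) (hp.1.1 x)
    _ = 1 := by simp [hp.1.2]

/-- For the stationary chain, `ℙ(a < T_A ≤ a + k) ≤ k / a`. -/
lemma stationary_hit_le (hP : IsStochastic P) {p : S → ℝ} (hp : IsStationary P p)
    {a : ℕ} (ha : 0 < a) (k : ℕ) :
    ∑ x, p x * (avoidProb P A a x - avoidProb P A (a + k) x) ≤ k / a := by
  set g : ℕ → ℝ := fun n => ∑ x, p x * avoidProb P A n x with hg
  set r : ℕ → ℝ := fun n => ∑ x, p x * (avoidProb P A n x - avoidProb P A (n + 1) x) with hr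
  have hanti : Antitone r := stationary_hit_antitone hP hp
  have hrg : ∀ n, r n = g n - g (n + 1) := fun n => by
    simp [hr, hg, mul_sub, Finset.sum_sub_distrib]
  have htel : ∀ n m, g n - g (n + m) = ∑ i ∈ Finset.range m, r (n + i) := by
    intro n m
    induction m with
    | zero => simp
    | succ m ih => rw [Finset.sum_range_succ, ← ih, hrg]; ring_nf
  -- The `a` masses `r 0, …, r (a - 1)` all dominate `r a` and have total at most 1.
  have h1 : (a : ℝ) * r a ≤ 1 := by
    have h2 : (a : ℝ) * r a ≤ g 0 - g (0 + a) := by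
      rw [htel]
      calc (a : ℝ) * r a = ∑ _i ∈ Finset.range a, r a := by simp
        _ ≤ _ := Finset.sum_le_sum fun i hi => hanti (by have := Finset.mem_range.1 hi; omega)
    have h3 : 0 ≤ g (0 + a) :=
      Finset.sum_nonneg fun x _ => mul_nonneg (hp.1.1 x) (avoidProb_nonneg hP _ x)
    have h4 : g 0 ≤ 1 := sum_stationary_avoidProb_le_one hP hp 0
    linarith
  have h5 : g a - g (a + k) ≤ k * r a := by
    rw [htel]
    calc _ ≤ ∑ _i ∈ Finset.range k, r a :=
          Finset.sum_le_sum fun i _ => hanti (by omega)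
      _ = k * r a := by simp
  have ha' : (0 : ℝ) < a := by exact_mod_cast ha
  calc ∑ x, p x * (avoidProb P A a x - avoidProb P A (a + k) x) = g a - g (a + k) := by
        simp [hg, mul_sub, Finset.sum_sub_distrib]
    _ ≤ k * r a := h5
    _ ≤ k / a := by
        rw [div_eq_mul_inv]
        refine mul_le_mul_of_nonneg_left ?_ k.cast_nonneg
        rw [← one_div, le_div_iff₀ ha']
        linarith

-- A path sitting at `a ∈ A` at time `n` has not avoided `A`.
open scoped Classical in
lemma avoidProb_le_one_sub_pow (hP : IsStochastic P) {a : S} (ha : a ∈ A) (n : ℕ) (x : S) :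
    avoidProb P A n x ≤ 1 - (P ^ n) x a := by
  have hpow : ∀ n x, (P ^ n) x a ≤ 1 ∧ 0 ≤ (P ^ n) x a := by
    intro n
    induction n with
    | zero => intro x; rw [pow_zero, Matrix.one_apply]; split_ifs <;> norm_num
    | succ n ih =>
      intro x
      rw [pow_succ', Matrix.mul_apply]
      refine ⟨?_, Finset.sum_nonneg fun y _ => mul_nonneg (hP.1 x y) (ih y).2⟩
      calc ∑ y, P x y * (P ^ n) y a ≤ ∑ y, P x y * 1 :=
            Finset.sum_le_sum fun y _ => mul_le_mul_of_nonneg_left (ih y).1 (hP.1 x y)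
        _ = 1 := by simp [hP.2 x]
  induction n generalizing x with
  | zero =>
    by_cases hx : x ∈ A
    · rw [avoidProb_of_mem hx]; exact sub_nonneg.2 (hpow 0 x).1
    · have : x ≠ a := fun h => hx (h ▸ ha)
      simp [avoidProb_zero_of_notMem hx, this]
  | succ n ih =>
    by_cases hx : x ∈ A
    · rw [avoidProb_of_mem hx]; exact sub_nonneg.2 (hpow (n + 1) x).1
    · rw [avoidProb_succ_of_notMem hx, pow_succ', Matrix.mul_apply]
      calc ∑ y, P x y * avoidProb P A n y ≤ ∑ y, P x y * (1 - (P ^ n) y a) :=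
            Finset.sum_le_sum fun y _ => mul_le_mul_of_nonneg_left (ih y) (hP.1 x y)
        _ = 1 - ∑ y, P x y * (P ^ n) y a := by
            simp [mul_sub, Finset.sum_sub_distrib, hP.2 x]

/-- Markov property at time `m`: wherever the chain then is, surviving `n` more steps costs a factor
at most `ρ`. Iterating this gives geometric decay. -/
lemma avoidProb_add_le (hP : IsStochastic P) {n : ℕ} {ρ : ℝ}
    (hρ : ∀ x, avoidProb P A n x ≤ ρ) (m : ℕ) (x : S) :
    avoidProb P A (m + n) x ≤ ρ * avoidProb P A m x := by
  induction m generalizing x with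
  | zero =>
    by_cases hx : x ∈ A
    · simp [avoidProb_of_mem hx]
    · simpa [avoidProb_zero_of_notMem hx] using hρ x
  | succ m ih =>
    by_cases hx : x ∈ A
    · simp [avoidProb_of_mem hx]
    · rw [show m + 1 + n = m + n + 1 by ring, avoidProb_succ_of_notMem hx,
        avoidProb_succ_of_notMem hx, Finset.mul_sum]
      refine Finset.sum_le_sum fun y _ => ?_
      calc P x y * avoidProb P A (m + n) y ≤ P x y * (ρ * avoidProb P A m y) :=
            mul_le_mul_of_nonneg_left (ih y) (hP.1 x y)
        _ = ρ * (P x y * avoidProb P A m y) := by ring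

/-- For an irreducible chain, the tail of the hitting time decays geometrically. -/
lemma exists_avoidProb_mul_le_pow (hP : IsStochastic P) (hirr : P.IsIrreducible)
    (hA : A.Nonempty) :
    ∃ (M : ℕ) (ρ : ℝ), 0 < M ∧ 0 ≤ ρ ∧ ρ < 1 ∧ ∀ (k : ℕ) (x : S), avoidProb P A (k * M) x ≤ ρ ^ k := by
  classical
  obtain ⟨a, ha⟩ := hA
  have : Nonempty S := ⟨a⟩
  have hk := (Matrix.isIrreducible_iff_exists_pow_pos hP.1).1 hirr
  choose K _ hK using fun x => hk x a
  -- A common horizon within which every state can reach `a`; the `+ 1` makes it visibly positive.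
  set M := Finset.univ.sup K + 1
  have hlt : ∀ x, avoidProb P A M x < 1 := fun x =>
    calc avoidProb P A M x ≤ avoidProb P A (K x) x :=
          avoidProb_antitone hP x ((Finset.le_sup (Finset.mem_univ x)).trans (Nat.le_succ _))
      _ ≤ 1 - (P ^ K x) x a := avoidProb_le_one_sub_pow hP ha _ x
      _ < 1 := by linarith [hK x]
  obtain ⟨x₀, hx₀⟩ := Finite.exists_max fun x => avoidProb P A M x
  refine ⟨M, avoidProb P A M x₀, Nat.succ_pos _, avoidProb_nonneg hP _ _, hlt x₀, fun k => ?_⟩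
  induction k with
  | zero => intro x; simpa using avoidProb_le_one hP 0 x
  | succ k ih =>
    intro x
    rw [add_mul, one_mul, pow_succ']
    exact (avoidProb_add_le hP hx₀ _ x).trans
      (mul_le_mul_of_nonneg_left (ih x) (avoidProb_nonneg hP _ _))

end AvoidProb

/-! ### The trivial lower bound on the top eigenvalue. -/

section Eigenvalue

variable {S : Type*} [Fintype S]

/-- The restricted matrix has row sums at most 1, so reading the eigenvector equation at a
coordinate of maximal modulus gives `|r| ≤ 1`. If there is no eigenvalue, the real supremum of the
empty set is 0. -/
lemma neg_one_le_topEigenvalue {P : Matrix S S ℝ} (hP : IsStochastic P) (A : Set S) :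
    -1 ≤ topEigenvalue P A := by
  classical
  unfold topEigenvalue
  set E : Set ℝ := {r : ℝ | Module.End.HasEigenvalue
    (Matrix.toLin' (P.submatrix ((↑) : {x // x ∉ A} → S) ((↑) : {x // x ∉ A} → S))) r}
  have habs : ∀ r ∈ E, |r| ≤ 1 := by
    intro r hr
    obtain ⟨v, hv⟩ := hr.exists_hasEigenvector
    obtain ⟨z, hz⟩ := Function.ne_iff.1 hv.2
    have : Nonempty {x // x ∉ A} := ⟨z⟩
    obtain ⟨x, hx⟩ := Finite.exists_max fun x => |v x|
    have hpos : 0 < |v x| := (abs_pos.2 hz).trans_le (hx z)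
    have hrow : ∑ y : {x // x ∉ A}, P x y ≤ 1 := by
      calc ∑ y : {x // x ∉ A}, P x y = ∑ y ∈ Finset.univ.filter (· ∉ A), P x y :=
            (Finset.sum_subtype _ (by simp) fun y => P x y).symm
        _ ≤ ∑ y, P x y := Finset.sum_le_univ_sum_of_nonneg fun y => hP.1 x y
        _ = 1 := hP.2 x
    have heq := congrFun hv.apply_eq_smul x
    rw [Matrix.toLin'_apply] at heq
    have hle : |r| * |v x| ≤ 1 * |v x| :=
      calc |r| * |v x| = |∑ y : {x // x ∉ A}, P x y * v y| := by
            rw [← abs_mul]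
            exact congrArg abs heq.symm
        _ ≤ ∑ y : {x // x ∉ A}, |P x y * v y| := Finset.abs_sum_le_sum_abs _ _
        _ ≤ ∑ y : {x // x ∉ A}, P x y * |v x| := Finset.sum_le_sum fun y _ => by
            rw [abs_mul, abs_of_nonneg (hP.1 _ _)]
            exact mul_le_mul_of_nonneg_left (hx y) (hP.1 _ _)
        _ = (∑ y : {x // x ∉ A}, P x y) * |v x| := (Finset.sum_mul _ _ _).symm
        _ ≤ 1 * |v x| := mul_le_mul_of_nonneg_right hrow hpos.le
    exact le_of_mul_le_mul_right hle hpos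
  rcases E.eq_empty_or_nonempty with h | ⟨r, hr⟩
  · rw [h, Real.sSup_empty]; norm_num
  · exact (abs_le.1 (habs r hr)).1.trans
      (le_csSup ⟨1, fun s hs => (abs_le.1 (habs s hs)).2⟩ hr)

end Eigenvalue

/-! ### Transfer to the process: Markov property and comparison with stationarity. -/

section Markov

variable {S Ω : Type*} [Fintype S] [MeasurableSpace Ω] {μ : Measure Ω} {P : Matrix S S ℝ}
  {X : ℕ → Ω → S} {A : Set S} {p : S → ℝ}

lemma IsMarkovChain.measurableSet_preimage (hX : IsMarkovChain P μ X) (n : ℕ) (B : Set S) :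
    MeasurableSet {ω | X n ω ∈ B} :=
  hX.1 n (show @MeasurableSet S ⊤ B from trivial)

/-- The event that the path avoids `A` at all times `m, …, m + n`. -/
def avoidEvent (X : ℕ → Ω → S) (A : Set S) (m n : ℕ) : Set Ω :=
  {ω | ∀ j, m ≤ j → j ≤ m + n → X j ω ∉ A}

lemma IsMarkovChain.measurableSet_avoidEvent (hX : IsMarkovChain P μ X) (m n : ℕ) :
    MeasurableSet (avoidEvent X A m n) := by
  have : avoidEvent X A m n = ⋂ j, ⋂ (_ : m ≤ j), ⋂ (_ : j ≤ m + n), {ω | X j ω ∈ Aᶜ} := by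
    ext ω; simp [avoidEvent]
  rw [this]
  exact .iInter fun j => .iInter fun _ => .iInter fun _ => hX.measurableSet_preimage j _

lemma avoidEvent_anti (X : ℕ → Ω → S) (A : Set S) (m : ℕ) {n n' : ℕ} (h : n ≤ n') :
    avoidEvent X A m n' ⊆ avoidEvent X A m n :=
  fun _ hω j h1 h2 => hω j h1 (by omega)

lemma measureReal_eq_sum_inter [IsFiniteMeasure μ] {β : Type*} [Fintype β] (f : Ω → β)
    (hf : ∀ b, MeasurableSet (f ⁻¹' {b})) (E : Set Ω) :
    μ.real E = ∑ b, μ.real (f ⁻¹' {b} ∩ E) := by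
  have h := sum_measureReal_preimage_singleton (μ := μ.restrict E) Finset.univ (f := f)
    (fun b _ => hf b)
  simp only [Finset.coe_univ, Set.preimage_univ] at h
  rw [measureReal_restrict_apply .univ, Set.univ_inter] at h
  rw [← h]
  exact Finset.sum_congr rfl fun b _ => measureReal_restrict_apply (hf b)

/-- Induction on `k`, splitting by the state at time `n + 1` and lengthening the prescribed path by
that state. -/
lemma IsMarkovChain.measureReal_path_inter_avoidEvent [IsFiniteMeasure μ]
    (hX : IsMarkovChain P μ X) (k n : ℕ) (x : ℕ → S) :
    μ.real ({ω | ∀ i ≤ n, X i ω = x i} ∩ avoidEvent X A n k) =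
      μ.real {ω | ∀ i ≤ n, X i ω = x i} * avoidProb P A k (x n) := by
  classical
  induction k generalizing n x with
  | zero =>
    by_cases hx : x n ∈ A
    · rw [avoidProb_of_mem hx, mul_zero]
      convert measureReal_empty (μ := μ) using 2
      ext ω
      simp only [Set.mem_inter_iff, Set.mem_ofPred_eq, Set.mem_empty_iff_false, iff_false, not_and]
      exact fun h h' => h' n le_rfl (by omega) (h n le_rfl ▸ hx)
    · rw [avoidProb_zero_of_notMem hx, mul_one]
      congr 1
      refine Set.inter_eq_left.2 fun ω hω j h1 h2 => ?_
      obtain rfl : j = n := by omega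
      rw [hω j le_rfl]
      exact hx
  | succ k ih =>
    by_cases hx : x n ∈ A
    · rw [avoidProb_of_mem hx, mul_zero]
      convert measureReal_empty (μ := μ) using 2
      ext ω
      simp only [Set.mem_inter_iff, Set.mem_ofPred_eq, Set.mem_empty_iff_false, iff_false, not_and]
      exact fun h h' => h' n le_rfl (by omega) (h n le_rfl ▸ hx)
    · rw [avoidProb_succ_of_notMem hx, Finset.mul_sum,
        measureReal_eq_sum_inter (X (n + 1)) fun b => hX.measurableSet_preimage (n + 1) {b}]
      refine Finset.sum_congr rfl fun y _ => ?_
      have hu : ∀ i ≤ n, Function.update x (n + 1) y i = x i := fun i hi =>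
        Function.update_of_ne (by omega) _ _
      have h1 := ih (n + 1) (Function.update x (n + 1) y)
      rw [hX.2 n, Function.update_self, hu n le_rfl] at h1
      have h2 : {ω | ∀ i ≤ n, X i ω = Function.update x (n + 1) y i} =
          {ω | ∀ i ≤ n, X i ω = x i} := by
        ext ω
        exact forall₂_congr fun i hi => by rw [hu i hi]
      rw [h2, mul_assoc] at h1
      rw [← h1]
      congr 1
      ext ω
      simp only [Set.mem_inter_iff, Set.mem_preimage, Set.mem_singleton_iff, Set.mem_ofPred_eq,
        avoidEvent]
      constructor
      · rintro ⟨hy, hpath, hav⟩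
        refine ⟨fun i hi => ?_, fun j hj1 hj2 => hav j (by omega) (by omega)⟩
        rcases Nat.lt_or_ge n i with h | h
        · obtain rfl : i = n + 1 := by omega
          simpa using hy
        · rw [hu i h]; exact hpath i h
      · rintro ⟨hpath, hav⟩
        have hpath' : ∀ i ≤ n, X i ω = x i := fun i hi => by
          rw [← hu i hi]; exact hpath i (by omega)
        refine ⟨by simpa using hpath (n + 1) le_rfl, hpath', fun j hj1 hj2 => ?_⟩
        rcases Nat.lt_or_ge n j with h | h
        · exact hav j h (by omega)
        · obtain rfl : j = n := by omega
          rw [hpath' j le_rfl]; exact hx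

/-- The Markov property: avoiding `A` during `[n, n + k]`, given the state at time `n`. -/
lemma IsMarkovChain.measureReal_avoidEvent [IsFiniteMeasure μ] (hX : IsMarkovChain P μ X)
    (n k : ℕ) :
    μ.real (avoidEvent X A n k) = ∑ x, μ.real {ω | X n ω = x} * avoidProb P A k x := by
  classical
  -- The chain property is phrased with infinite paths, so a finite path is frozen after time `n`.
  -- Finite paths are then summed, grouped by endpoint.
  let ext' : (Fin (n + 1) → S) → ℕ → S := fun u i => u ⟨min i n, by omega⟩
  let f : Ω → Fin (n + 1) → S := fun ω i => X i ω
  have hpre : ∀ u, f ⁻¹' {u} = {ω | ∀ i ≤ n, X i ω = ext' u i} := by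
    intro u
    ext ω
    simp only [Set.mem_preimage, Set.mem_singleton_iff, Set.mem_ofPred_eq, f, ext', funext_iff]
    constructor
    · intro h i hi
      have := h ⟨i, by omega⟩
      simpa [min_eq_left hi] using this
    · intro h i
      have := h i (by omega)
      simpa [min_eq_left (show (i : ℕ) ≤ n by omega)] using this
  have hf : ∀ u, MeasurableSet (f ⁻¹' {u}) := by
    intro u
    rw [hpre]
    have : {ω | ∀ i ≤ n, X i ω = ext' u i} =
        ⋂ i, ⋂ (_ : i ≤ n), {ω | X i ω ∈ ({ext' u i} : Set S)} := by
      ext ω; simp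
    rw [this]
    exact .iInter fun i => .iInter fun _ => hX.measurableSet_preimage i _
  have hlast : ∀ u, ext' u n = u (Fin.last n) := fun u => by simp [ext', Fin.last]
  have key : ∀ u, μ.real (f ⁻¹' {u} ∩ avoidEvent X A n k) =
      μ.real (f ⁻¹' {u}) * avoidProb P A k (u (Fin.last n)) := fun u => by
    rw [hpre, hX.measureReal_path_inter_avoidEvent, hlast]
  rw [measureReal_eq_sum_inter f hf, Finset.sum_congr rfl fun u _ => key u,
    ← Finset.sum_fiberwise Finset.univ (fun u : Fin (n + 1) → S => u (Fin.last n))]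
  refine Finset.sum_congr rfl fun x _ => ?_
  rw [measureReal_eq_sum_inter f hf, Finset.sum_mul, Finset.sum_filter]
  refine Finset.sum_congr rfl fun u _ => ?_
  split_ifs with h
  · subst h
    congr 2
    refine (Set.inter_eq_left.2 fun ω hω => ?_).symm
    exact congrFun hω (Fin.last n)
  · have : f ⁻¹' {u} ∩ {ω | X n ω = x} = ∅ := by
      ext ω
      simp only [Set.mem_inter_iff, Set.mem_preimage, Set.mem_singleton_iff, Set.mem_ofPred_eq,
        Set.mem_empty_iff_false, iff_false, not_and]
      rintro rfl hx
      exact h hx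
    rw [this]; simp

lemma IsMarkovChain.sum_measureReal_eq_one [IsProbabilityMeasure μ] (hX : IsMarkovChain P μ X)
    (n : ℕ) : ∑ x, μ.real {ω | X n ω = x} = 1 := by
  have := measureReal_eq_sum_inter (μ := μ) (X n)
    (fun b => hX.measurableSet_preimage n {b}) Set.univ
  rw [probReal_univ] at this
  rw [this]
  exact Finset.sum_congr rfl fun x _ => by rw [Set.inter_univ]; rfl

lemma tvDist_nonneg (μ : Measure Ω) (X : ℕ → Ω → S) (p : S → ℝ) (n : ℕ) : 0 ≤ tvDist μ X p n :=
  mul_nonneg (by norm_num) (Finset.sum_nonneg fun _ _ => abs_nonneg _)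

lemma IsHaltingSet.tvDist_le_one [IsProbabilityMeasure μ] (h : IsHaltingSet μ X p A) (n : ℕ) :
    tvDist μ X p n ≤ 1 :=
  (h n).trans measureReal_le_one

/-- For `0 ≤ q ≤ 1`, the difference of the laws times `q` is at most its positive part, half of
absolute value plus signed value; the signed values sum to 0. -/
lemma sum_mul_le_sum_mul_add_tvDist [IsProbabilityMeasure μ] (hX : IsMarkovChain P μ X)
    (hp : IsStationary P p) (n : ℕ) {q : S → ℝ} (hq0 : ∀ x, 0 ≤ q x) (hq1 : ∀ x, q x ≤ 1) :
    ∑ x, μ.real {ω | X n ω = x} * q x ≤ ∑ x, p x * q x + tvDist μ X p n := by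
  have h1 : ∀ x, (μ.real {ω | X n ω = x} - p x) * q x ≤
      1 / 2 * |μ.real {ω | X n ω = x} - p x| + 1 / 2 * (μ.real {ω | X n ω = x} - p x) := by
    intro x
    rcases le_total 0 (μ.real {ω | X n ω = x} - p x) with h | h
    · rw [abs_of_nonneg h]; nlinarith [hq1 x]
    · rw [abs_of_nonpos h]; nlinarith [hq0 x]
  have h2 := Finset.sum_le_sum fun x (_ : x ∈ Finset.univ) => h1 x
  simp only [sub_mul] at h2
  rw [Finset.sum_sub_distrib, Finset.sum_add_distrib, ← Finset.mul_sum, ← Finset.mul_sum,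
    Finset.sum_sub_distrib, hX.sum_measureReal_eq_one, hp.1.2] at h2
  unfold tvDist
  linarith

lemma lt_hittingTime_iff {ω : Ω} {n : ℕ} :
    (n : WithTop ℕ) < hittingTime X A ω ↔ ω ∈ avoidEvent X A 0 n := by
  rw [← not_le, hittingTime]
  change ¬ hittingAfter X A 0 ω ≤ WithTop.some n ↔ _
  rw [hittingAfter_le_iff]
  simp [avoidEvent]

/-- A lower bound for the distance to stationarity in terms of the hitting time. -/
lemma measureReal_hit_sub_le_tvDist [IsProbabilityMeasure μ] (hP : IsStochastic P)
    (hX : IsMarkovChain P μ X) (hp : IsStationary P p) (n k : ℕ) {a : ℕ} (ha : 0 < a) :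
    μ.real {ω | ((n + a : ℕ) : WithTop ℕ) < hittingTime X A ω ∧
      ¬ ((n + a + k : ℕ) : WithTop ℕ) < hittingTime X A ω} - k / a ≤ tvDist μ X p n := by
  have hsub : {ω | ((n + a : ℕ) : WithTop ℕ) < hittingTime X A ω ∧
      ¬ ((n + a + k : ℕ) : WithTop ℕ) < hittingTime X A ω} ⊆
      avoidEvent X A n a \ avoidEvent X A n (a + k) := by
    rintro ω ⟨h1, h2⟩
    rw [lt_hittingTime_iff] at h1 h2
    refine ⟨fun j _ hj => h1 j (by omega) (by omega), fun h => h2 fun j _ hj => ?_⟩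
    rcases Nat.lt_or_ge j n with hjn | hjn
    · exact h1 j (by omega) (by omega)
    · exact h j hjn (by omega)
  have h1 := (measureReal_mono (μ := μ) hsub).trans_eq
    (measureReal_sdiff (avoidEvent_anti X A n (Nat.le_add_right a k))
      (hX.measurableSet_avoidEvent n _))
  rw [hX.measureReal_avoidEvent, hX.measureReal_avoidEvent, ← Finset.sum_sub_distrib] at h1
  simp_rw [← mul_sub] at h1
  -- The test function is the probability, from `x`, of first hitting `A` at a time in `(a, a + k]`.
  have h2 := sum_mul_le_sum_mul_add_tvDist hX hp n
    (q := fun x => avoidProb P A a x - avoidProb P A (a + k) x)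
    (fun x => sub_nonneg.2 (avoidProb_antitone hP x (Nat.le_add_right a k)))
    (fun x => by linarith [avoidProb_le_one (A := A) hP a x, avoidProb_nonneg (A := A) hP (a + k) x])
  have h3 := stationary_hit_le (A := A) hP hp ha k
  linarith

end Markov

end HaltingCutoff

namespace HaltingCutoff

/-! ### Moments of the hitting time and the two quantitative bounds on the distance. -/

section Moments

variable {S Ω : Type*} [Fintype S] [MeasurableSpace Ω] {μ : Measure Ω} {P : Matrix S S ℝ}
  {X : ℕ → Ω → S} {A : Set S} {p : S → ℝ}

lemma setOf_lt_hittingTime (X : ℕ → Ω → S) (A : Set S) (n : ℕ) :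
    {ω | (n : WithTop ℕ) < hittingTime X A ω} = avoidEvent X A 0 n :=
  Set.ext fun _ => lt_hittingTime_iff

lemma IsMarkovChain.measurableSet_lt_hittingTime (hX : IsMarkovChain P μ X) (n : ℕ) :
    MeasurableSet {ω | (n : WithTop ℕ) < hittingTime X A ω} := by
  rw [setOf_lt_hittingTime]
  exact hX.measurableSet_avoidEvent 0 n

lemma lt_hittingTime_of_lt_untopD {ω : Ω} {n : ℕ} (h : n < (hittingTime X A ω).untopD 0) :
    (n : WithTop ℕ) < hittingTime X A ω := by
  induction hω : hittingTime X A ω with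
  | top => exact WithTop.coe_lt_top n
  | coe m =>
    rw [hω] at h
    exact WithTop.coe_lt_coe.2 h

lemma lt_realHittingTime_iff {ω : Ω} (hω : hittingTime X A ω ≠ ⊤) {n : ℕ} :
    (n : ℝ) < realHittingTime X A ω ↔ (n : WithTop ℕ) < hittingTime X A ω := by
  unfold realHittingTime
  lift hittingTime X A ω to ℕ using hω with m
  rw [WithTop.untopD_coe, Nat.cast_lt]
  exact WithTop.coe_lt_coe.symm

lemma IsMarkovChain.measurable_realHittingTime (hX : IsMarkovChain P μ X) :
    Measurable (realHittingTime X A) := by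
  refine (measurable_from_top (f := fun n : ℕ => (n : ℝ))).comp
    (f := fun ω => (hittingTime X A ω).untopD 0) (measurable_of_Ioi fun n => ?_)
  -- The value `⊤` is read as 0, so the event of never hitting must be removed from `{n < T_A}`.
  have : (fun ω => (hittingTime X A ω).untopD 0) ⁻¹' Set.Ioi n =
      {ω | (n : WithTop ℕ) < hittingTime X A ω} \
        ⋂ m : ℕ, {ω | (m : WithTop ℕ) < hittingTime X A ω} := by
    ext ω
    simp only [Set.mem_preimage, Set.mem_Ioi, Set.mem_sdiff, Set.mem_ofPred_eq, Set.mem_iInter]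
    induction hω : hittingTime X A ω with
    | top => simp [WithTop.natCast_lt_top]
    | coe m =>
      rw [WithTop.untopD_coe]
      exact ⟨fun h => ⟨WithTop.coe_lt_coe.2 h, fun h' => lt_irrefl _ (h' m)⟩,
        fun h => WithTop.coe_lt_coe.1 h.1⟩
  rw [this]
  exact (hX.measurableSet_lt_hittingTime n).diff
    (.iInter fun m => hX.measurableSet_lt_hittingTime m)

lemma IsMarkovChain.exists_measureReal_lt_hittingTime_le_pow [IsProbabilityMeasure μ]
    (hX : IsMarkovChain P μ X) (hP : IsStochastic P) (hirr : P.IsIrreducible) (hA : A.Nonempty) :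
    ∃ (M : ℕ) (ρ : ℝ), 0 < M ∧ 0 ≤ ρ ∧ ρ < 1 ∧
      ∀ k : ℕ, μ.real {ω | ((k * M : ℕ) : WithTop ℕ) < hittingTime X A ω} ≤ ρ ^ k := by
  obtain ⟨M, ρ, hM, hρ0, hρ1, h⟩ := exists_avoidProb_mul_le_pow hP hirr hA
  refine ⟨M, ρ, hM, hρ0, hρ1, fun k => ?_⟩
  rw [setOf_lt_hittingTime, hX.measureReal_avoidEvent]
  calc ∑ x, μ.real {ω | X 0 ω = x} * avoidProb P A (k * M) x
      ≤ ∑ x, μ.real {ω | X 0 ω = x} * ρ ^ k :=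
        Finset.sum_le_sum fun x _ => mul_le_mul_of_nonneg_left (h k x) measureReal_nonneg
    _ = ρ ^ k := by rw [← Finset.sum_mul, hX.sum_measureReal_eq_one, one_mul]

lemma IsMarkovChain.ae_hittingTime_ne_top [IsProbabilityMeasure μ]
    (hX : IsMarkovChain P μ X) (hP : IsStochastic P) (hirr : P.IsIrreducible) (hA : A.Nonempty) :
    ∀ᵐ ω ∂μ, hittingTime X A ω ≠ ⊤ := by
  obtain ⟨M, ρ, -, hρ0, hρ1, h⟩ :=
    hX.exists_measureReal_lt_hittingTime_le_pow hP hirr hA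
  have hle : ∀ k : ℕ, μ.real {ω | ¬ hittingTime X A ω ≠ ⊤} ≤ ρ ^ k := fun k =>
    (measureReal_mono fun ω hω => by
      rw [Set.mem_ofPred_eq, not_not.1 hω]; exact WithTop.coe_lt_top _).trans (h k)
  have h0 : μ.real {ω | ¬ hittingTime X A ω ≠ ⊤} ≤ 0 :=
    ge_of_tendsto' (tendsto_pow_atTop_nhds_zero_of_lt_one hρ0 hρ1) hle
  exact (measureReal_eq_zero_iff).1 (le_antisymm h0 measureReal_nonneg)

/-- A layer-cake bound for the square on a grid of mesh `M`, matching the times at which the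
geometric tail is known. With `K = ⌈T / M⌉`, the terms `k < K` are active, and the first `K` odd
numbers sum to `K²`. -/
lemma natCast_sq_le_tsum (M T : ℕ) (hM : 0 < M) :
    (T : ENNReal) ^ 2 ≤
      ∑' k : ℕ, if k * M < T then ((M ^ 2 * (2 * k + 1) : ℕ) : ENNReal) else 0 := by
  set K := (T + M - 1) / M
  have hlt : ∀ k < K, k * M < T := fun k hk => by
    have := (Nat.le_div_iff_mul_le hM).1 (Nat.succ_le_of_lt hk)
    rw [Nat.succ_mul] at this
    omega
  have hle : T ≤ M * K := by
    have h1 := Nat.div_add_mod (T + M - 1) M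
    have h2 := Nat.mod_lt (T + M - 1) hM
    change M * K + _ = _ at h1
    omega
  have hsq : ∑ k ∈ Finset.range K, M ^ 2 * (2 * k + 1) = (M * K) ^ 2 := by
    rw [← Finset.mul_sum, mul_pow]
    congr 1
    induction K with
    | zero => simp
    | succ K ih => rw [Finset.sum_range_succ, ih]; ring
  calc (T : ENNReal) ^ 2 ≤ (((M * K) ^ 2 : ℕ) : ENNReal) := by
        exact_mod_cast Nat.pow_le_pow_left hle 2
    _ = ∑ k ∈ Finset.range K,
          if k * M < T then ((M ^ 2 * (2 * k + 1) : ℕ) : ENNReal) else 0 := by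
        rw [← hsq, Nat.cast_sum]
        exact Finset.sum_congr rfl fun k hk => by rw [if_pos (hlt k (Finset.mem_range.1 hk))]
    _ ≤ _ := ENNReal.sum_le_tsum _

/-- The hitting time of a nonempty set by an irreducible finite chain is square integrable. -/
lemma IsMarkovChain.memLp_realHittingTime [IsProbabilityMeasure μ]
    (hX : IsMarkovChain P μ X) (hP : IsStochastic P) (hirr : P.IsIrreducible) (hA : A.Nonempty) :
    MemLp (realHittingTime X A) 2 μ := by
  obtain ⟨M, ρ, hM, hρ0, hρ1, h⟩ :=
    hX.exists_measureReal_lt_hittingTime_le_pow hP hirr hA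
  have hmeas : Measurable (realHittingTime X A) := hX.measurable_realHittingTime
  rw [memLp_two_iff_integrable_sq hmeas.aestronglyMeasurable]
  refine ⟨(hmeas.pow_const 2).aestronglyMeasurable, ?_⟩
  have hsum : Summable fun k : ℕ => ((M ^ 2 * (2 * k + 1) : ℕ) : ℝ) * ρ ^ k := by
    have h1 := summable_pow_mul_geometric_of_norm_lt_one (R := ℝ) 1 (r := ρ)
      (by rwa [Real.norm_of_nonneg hρ0])
    have h0 := summable_geometric_of_lt_one hρ0 hρ1
    refine ((h1.mul_left (2 * (M : ℝ) ^ 2)).add (h0.mul_left ((M : ℝ) ^ 2))).congr fun k => ?_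
    push_cast
    ring
  have hpt : ∀ ω, ‖realHittingTime X A ω ^ 2‖ₑ ≤
      ∑' k : ℕ, {ω | ((k * M : ℕ) : WithTop ℕ) < hittingTime X A ω}.indicator
        (fun _ => ((M ^ 2 * (2 * k + 1) : ℕ) : ENNReal)) ω := by
    intro ω
    have h1 : ‖realHittingTime X A ω ^ 2‖ₑ = (((hittingTime X A ω).untopD 0 : ℕ) : ENNReal) ^ 2 := by
      rw [enorm_pow, realHittingTime, Real.enorm_natCast]
    rw [h1]
    refine (natCast_sq_le_tsum M _ hM).trans (ENNReal.tsum_le_tsum fun k => ?_)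
    split_ifs with hk
    · rw [Set.indicator_of_mem]
      exact lt_hittingTime_of_lt_untopD hk
    · exact zero_le
  calc ∫⁻ ω, ‖realHittingTime X A ω ^ 2‖ₑ ∂μ
      ≤ ∫⁻ ω, ∑' k : ℕ, {ω | ((k * M : ℕ) : WithTop ℕ) < hittingTime X A ω}.indicator
        (fun _ => ((M ^ 2 * (2 * k + 1) : ℕ) : ENNReal)) ω ∂μ := lintegral_mono hpt
    _ = ∑' k : ℕ, ((M ^ 2 * (2 * k + 1) : ℕ) : ENNReal) *
          μ {ω | ((k * M : ℕ) : WithTop ℕ) < hittingTime X A ω} := by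
        rw [lintegral_tsum fun k => (measurable_const.indicator
          (hX.measurableSet_lt_hittingTime _)).aemeasurable]
        exact tsum_congr fun k => lintegral_indicator_const (hX.measurableSet_lt_hittingTime _) _
    _ ≤ ∑' k : ℕ, ENNReal.ofReal (((M ^ 2 * (2 * k + 1) : ℕ) : ℝ) * ρ ^ k) := by
        refine ENNReal.tsum_le_tsum fun k => ?_
        rw [ENNReal.ofReal_mul (Nat.cast_nonneg _), ENNReal.ofReal_natCast]
        gcongr
        rw [← ofReal_measureReal]
        exact ENNReal.ofReal_le_ofReal (h k)
    _ < ⊤ := by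
        rw [← ENNReal.ofReal_tsum_of_nonneg
          (fun k => mul_nonneg (Nat.cast_nonneg _) (pow_nonneg hρ0 k)) hsum]
        exact ENNReal.ofReal_lt_top

/-- Chebyshev's inequality for the hitting time. -/
lemma IsMarkovChain.measureReal_le_abs_realHittingTime_sub [IsProbabilityMeasure μ]
    (hX : IsMarkovChain P μ X) (hP : IsStochastic P) (hirr : P.IsIrreducible) (hA : A.Nonempty)
    {s : ℝ} (hs : 0 < s) :
    μ.real {ω | s ≤ |realHittingTime X A ω - meanHit μ X A|} ≤ stdHit μ X A ^ 2 / s ^ 2 := by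
  have h := meas_ge_le_variance_div_sq (hX.memLp_realHittingTime hP hirr hA) hs
  rw [stdHit, Real.sq_sqrt (variance_nonneg _ _)]
  exact ENNReal.toReal_le_of_le_ofReal (div_nonneg (variance_nonneg _ _) (sq_nonneg _)) h

lemma IsHaltingSet.tvDist_le [IsProbabilityMeasure μ] (hH : IsHaltingSet μ X p A)
    (hX : IsMarkovChain P μ X) (hP : IsStochastic P) (hirr : P.IsIrreducible) (hA : A.Nonempty)
    {s : ℝ} (hs : 0 < s) :
    tvDist μ X p ⌊meanHit μ X A + s⌋₊ ≤ stdHit μ X A ^ 2 / s ^ 2 := by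
  refine (hH _).trans (le_trans ?_ (hX.measureReal_le_abs_realHittingTime_sub hP hirr hA hs))
  -- The inclusion is only almost sure: on `T_A = ⊤` the real hitting time is 0.
  refine ENNReal.toReal_mono (by finiteness) (measure_mono_ae ?_)
  filter_upwards [hX.ae_hittingTime_ne_top hP hirr hA] with ω hω hlt
  have h1 := (lt_realHittingTime_iff hω).2 hlt
  have h2 : meanHit μ X A + s ≤ realHittingTime X A ω := by
    rw [realHittingTime, Nat.cast_lt] at h1
    exact (Nat.lt_of_floor_lt h1).le
  exact le_trans (by linarith) (le_abs_self _)

/-- The Chebyshev window around the mean is fitted into `(n + a, n + a + k]` and compared with the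
stationary bound `k / a`. -/
lemma one_sub_le_tvDist [IsProbabilityMeasure μ]
    (hX : IsMarkovChain P μ X) (hP : IsStochastic P) (hirr : P.IsIrreducible) (hA : A.Nonempty)
    (hp : IsStationary P p) {y s : ℝ} (hy : 0 ≤ y) (hs : 0 < s)
    (hys : y + s + 1 < meanHit μ X A) :
    1 - stdHit μ X A ^ 2 / s ^ 2 - (2 * s + 3) / (meanHit μ X A - s - y - 1) ≤
      tvDist μ X p ⌊y⌋₊ := by
  set t := meanHit μ X A
  set n := ⌊y⌋₊
  set a := ⌊t - s - y⌋₊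
  -- The window has length `2 * s`; the extra 2 absorbs the two floors in `n` and `a`.
  set k := ⌈2 * s + 2⌉₊
  have hn1 : (n : ℝ) ≤ y := Nat.floor_le hy
  have hn2 : y < n + 1 := Nat.lt_floor_add_one y
  have ha1 : (a : ℝ) ≤ t - s - y := Nat.floor_le (by linarith)
  have ha2 : t - s - y < a + 1 := Nat.lt_floor_add_one _
  have hk1 : 2 * s + 2 ≤ k := Nat.le_ceil _
  have hk2 : (k : ℝ) < 2 * s + 2 + 1 := Nat.ceil_lt_add_one (by linarith)
  have ha : 0 < a := Nat.floor_pos.2 (by linarith)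
  have hlow := measureReal_hit_sub_le_tvDist (A := A) hP hX hp n k ha
  have hratio : (k : ℝ) / a ≤ (2 * s + 3) / (t - s - y - 1) := by
    apply div_le_div₀ <;> linarith
  have hmeas : MeasurableSet {ω | s ≤ |realHittingTime X A ω - t|} :=
    measurableSet_le measurable_const
      (continuous_abs.measurable.comp (hX.measurable_realHittingTime.sub_const t))
  have hcheb := hX.measureReal_le_abs_realHittingTime_sub hP hirr hA hs
  have hsub : {ω | s ≤ |realHittingTime X A ω - t|}ᶜ ⊆
      {ω | ((n + a : ℕ) : WithTop ℕ) < hittingTime X A ω ∧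
        ¬ ((n + a + k : ℕ) : WithTop ℕ) < hittingTime X A ω} := by
    intro ω hω
    have hlt : |realHittingTime X A ω - t| < s := not_le.1 fun h => hω h
    obtain ⟨h1, h2⟩ := abs_lt.1 hlt
    -- If `T_A = ⊤`, its real value 0 would be within `s` of `t`, although `s < t`.
    have hω' : hittingTime X A ω ≠ ⊤ := by
      intro htop
      rw [realHittingTime, htop, WithTop.untopD_top, Nat.cast_zero] at h1
      linarith
    refine ⟨?_, ?_⟩
    · rw [← lt_realHittingTime_iff hω']; push_cast; linarith
    · rw [← lt_realHittingTime_iff hω', not_lt]; push_cast; linarith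
  have h1 := measureReal_mono (μ := μ) hsub
  rw [probReal_compl_eq_one_sub hmeas] at h1
  linarith

end Moments

/-! ### Deducing the asymptotic statements from the two bounds. -/

section Limits

lemma le_liminf_of_unit {u : ℕ → ℝ} (h1 : ∀ n, u n ≤ 1) {b : ℝ}
    (hb : ∀ᶠ n in atTop, b ≤ u n) : b ≤ liminf u atTop :=
  le_liminf_of_le (isBoundedUnder_of ⟨1, h1⟩).isCoboundedUnder_ge hb

lemma liminf_le_one_of_unit {u : ℕ → ℝ} (h0 : ∀ n, 0 ≤ u n) (h1 : ∀ n, u n ≤ 1) :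
    liminf u atTop ≤ 1 :=
  liminf_le_of_le (isBoundedUnder_of ⟨0, h0⟩) fun _ hb =>
    let ⟨n, hn⟩ := hb.exists; hn.trans (h1 n)

lemma limsup_le_of_unit {u : ℕ → ℝ} (h0 : ∀ n, 0 ≤ u n) {b : ℝ}
    (hb : ∀ᶠ n in atTop, u n ≤ b) : limsup u atTop ≤ b :=
  limsup_le_of_le (isBoundedUnder_of ⟨0, h0⟩).isCoboundedUnder_le hb

lemma limsup_nonneg_of_unit {u : ℕ → ℝ} (h0 : ∀ n, 0 ≤ u n) (h1 : ∀ n, u n ≤ 1) :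
    0 ≤ limsup u atTop :=
  le_limsup_of_le (isBoundedUnder_of ⟨1, h1⟩) fun _ hb =>
    let ⟨n, hn⟩ := hb.exists; (h0 n).trans hn

variable {d : ℕ → ℕ → ℝ} {t w : ℕ → ℝ}

lemma hasCutoff_of_bounds (hd0 : ∀ N n, 0 ≤ d N n) (hd1 : ∀ N n, d N n ≤ 1)
    (hup : ∀ N s, 0 < s → d N ⌊t N + s⌋₊ ≤ w N ^ 2 / s ^ 2)
    (hlow : ∀ N y s, 0 ≤ y → 0 < s → y + s + 1 < t N →
      1 - w N ^ 2 / s ^ 2 - (2 * s + 3) / (t N - s - y - 1) ≤ d N ⌊y⌋₊)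
    (hwt : w =o[atTop] t) (ht : Tendsto t atTop atTop) : HasCutoff d t := by
  have hlim : ∀ ε : ℝ, Tendsto (fun N => w N ^ 2 / (ε * t N) ^ 2) atTop (𝓝 0) := by
    intro ε
    have := (hwt.tendsto_div_nhds_zero.pow 2).div_const (ε ^ 2)
    rw [zero_pow two_ne_zero, zero_div] at this
    refine this.congr fun N => ?_
    rw [div_pow, div_div, mul_pow, mul_comm (ε ^ 2)]
  constructor
  · intro c hc
    refine tendsto_of_tendsto_of_tendsto_of_le_of_le' tendsto_const_nhds (hlim (c - 1))
      (.of_forall fun N => hd0 N _) ?_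
    filter_upwards [ht.eventually_gt_atTop 0] with N hN
    have := hup N ((c - 1) * t N) (mul_pos (by linarith) hN)
    rwa [show t N + (c - 1) * t N = c * t N by ring] at this
  · intro c hc0 hc1
    refine tendsto_order.2 ⟨fun b hb => ?_, fun b hb => .of_forall fun N => (hd1 N _).trans_lt hb⟩
    set δ := 1 - c
    -- Use `s = θ * δ * t N`. Once `3 ≤ s`, the numerator is at most `3 * s` and the denominator at
    -- least `δ * t N / 2`, so the ratio is at most `6 * θ ≤ (1 - b) / 4`. The Chebyshev term takes
    -- `(1 - b) / 2`.
    set θ := min (1 / 4) ((1 - b) / 24)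
    have hδ : 0 < δ := sub_pos.2 hc1
    have hθ0 : 0 < θ := lt_min (by norm_num) (by linarith)
    have hθ1 : θ ≤ 1 / 4 := min_le_left _ _
    have hθ2 : θ ≤ (1 - b) / 24 := min_le_right _ _
    have hθδ : 0 < θ * δ := mul_pos hθ0 hδ
    filter_upwards [ht.eventually_gt_atTop 0, ht.eventually_ge_atTop (3 / (θ * δ)),
      (hlim (θ * δ)).eventually_lt_const (show 0 < (1 - b) / 2 by linarith)] with N hN0 hN1 hN2
    rw [div_le_iff₀ hθδ] at hN1
    have hδt : 0 < δ * t N := mul_pos hδ hN0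
    have hle : θ * (δ * t N) ≤ 1 / 4 * (δ * t N) := mul_le_mul_of_nonneg_right hθ1 hδt.le
    have hct : c * t N = t N - δ * t N := by simp only [δ]; ring
    have hs : θ * δ * t N = θ * (δ * t N) := mul_assoc _ _ _
    have h := hlow N (c * t N) (θ * δ * t N) (mul_nonneg hc0 hN0.le) (mul_pos hθδ hN0)
      (by rw [hct, hs]; linarith)
    have hratio : (2 * (θ * δ * t N) + 3) / (t N - θ * δ * t N - c * t N - 1) ≤ (1 - b) / 4 := by
      have hden : 0 < t N - θ * δ * t N - c * t N - 1 := by rw [hct, hs]; linarith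
      rw [div_le_iff₀ hden]
      have h2 : θ * (δ * t N) ≤ (1 - b) / 24 * (δ * t N) := mul_le_mul_of_nonneg_right hθ2 hδt.le
      have h3 : δ * t N / 2 ≤ t N - θ * δ * t N - c * t N - 1 := by rw [hct, hs]; linarith
      have h4 := mul_le_mul_of_nonneg_left h3 (show 0 ≤ (1 - b) / 4 by linarith)
      rw [hs] at h4 ⊢
      linarith
    linarith

lemma hasCutoffWindow_of_bounds (hd0 : ∀ N n, 0 ≤ d N n) (hd1 : ∀ N n, d N n ≤ 1)
    (hup : ∀ N s, 0 < s → d N ⌊t N + s⌋₊ ≤ w N ^ 2 / s ^ 2)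
    (hlow : ∀ N y s, 0 ≤ y → 0 < s → y + s + 1 < t N →
      1 - w N ^ 2 / s ^ 2 - (2 * s + 3) / (t N - s - y - 1) ≤ d N ⌊y⌋₊)
    (hwt : w =o[atTop] t) (ht : Tendsto t atTop atTop)
    {w₀ : ℝ} (hw₀ : 0 < w₀) (hw : ∀ᶠ N in atTop, w₀ ≤ w N) : HasCutoffWindow d t w := by
  refine ⟨hwt, ?_, ?_⟩
  -- This bound comes from `s = √γ * w N`, a scale between `w N` and the offset `γ * w N`: large
  -- against the deviation, small against the distance to the mean.
  · have hlim : Tendsto (fun γ : ℝ => 1 - 1 / √γ ^ 2 - 3 / (√γ - 2)) atTop (𝓝 1) := by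
      have h1 : Tendsto (fun γ : ℝ => 1 / √γ ^ 2) atTop (𝓝 0) :=
        tendsto_const_nhds.div_atTop
          ((tendsto_pow_atTop two_ne_zero).comp Real.tendsto_sqrt_atTop)
      have h2 : Tendsto (fun γ : ℝ => 3 / (√γ - 2)) atTop (𝓝 0) :=
        tendsto_const_nhds.div_atTop
          (tendsto_atTop_add_const_right _ (-2) Real.tendsto_sqrt_atTop)
      simpa using (tendsto_const_nhds.sub h1).sub h2
    refine tendsto_of_tendsto_of_tendsto_of_le_of_le' hlim tendsto_const_nhds ?_
      (.of_forall fun γ => liminf_le_one_of_unit (fun N => hd0 N _) fun N => hd1 N _)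
    filter_upwards [Real.tendsto_sqrt_atTop.eventually_ge_atTop 3,
      Real.tendsto_sqrt_atTop.eventually_ge_atTop (3 / w₀), eventually_gt_atTop 0]
      with γ hγ1 hγ2 hγ0
    rw [div_le_iff₀ hw₀] at hγ2
    refine le_liminf_of_unit (fun N => hd1 N _) ?_
    -- Ensures `γ * w N ≤ t N`, so that the time `t N - γ * w N` is nonnegative.
    have hsmall := (hwt.tendsto_div_nhds_zero).eventually_lt_const (inv_pos.2 hγ0)
    filter_upwards [hw, hsmall, ht.eventually_gt_atTop 0] with N hN1 hN2 hN3
    set u := √γ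
    have hγu : γ = u ^ 2 := (Real.sq_sqrt hγ0.le).symm
    have hwpos : 0 < w N := hw₀.trans_le hN1
    have huw : 3 ≤ u * w N := hγ2.trans (mul_le_mul_of_nonneg_left hN1 (by linarith))
    have huw2 : 3 * (u * w N) ≤ u * (u * w N) := mul_le_mul_of_nonneg_right hγ1 (by linarith)
    have hγw : γ * w N = u * (u * w N) := by rw [hγu]; ring
    have hγwt : γ * w N ≤ t N := by
      rw [div_lt_iff₀ hN3, inv_mul_eq_div, lt_div_iff₀ hγ0] at hN2
      linarith
    have h := hlow N (t N - γ * w N) (u * w N) (by linarith) (by linarith) (by linarith)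
    have h1 : w N ^ 2 / (u * w N) ^ 2 = 1 / u ^ 2 := by
      field_simp
    -- Since `3 ≤ u * w N`, the additive 3 and 1 are each absorbed in one more `u * w N`.
    have h2 : (2 * (u * w N) + 3) / (t N - u * w N - (t N - γ * w N) - 1) ≤ 3 / (u - 2) := by
      rw [div_le_div_iff₀ (by linarith) (by linarith), hγw]
      nlinarith
    rw [h1] at h
    linarith
  · have hlim : Tendsto (fun γ : ℝ => 1 / γ ^ 2) atTop (𝓝 0) :=
      tendsto_const_nhds.div_atTop (tendsto_pow_atTop two_ne_zero)
    refine tendsto_of_tendsto_of_tendsto_of_le_of_le' tendsto_const_nhds hlim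
      (.of_forall fun γ => limsup_nonneg_of_unit (fun N => hd0 N _) fun N => hd1 N _) ?_
    filter_upwards [eventually_gt_atTop 0] with γ hγ
    refine limsup_le_of_unit (fun N => hd0 N _) ?_
    filter_upwards [hw] with N hN
    have hwpos : 0 < w N := hw₀.trans_le hN
    refine (hup N (γ * w N) (mul_pos hγ hwpos)).trans_eq ?_
    field_simp

end Limits

end HaltingCutoff

theorem mainTheorem4
    (S : ℕ → Type*) [∀ N, Fintype (S N)]
    (Ω : ℕ → Type*) [∀ N, MeasurableSpace (Ω N)]
    (μ : ∀ N, Measure (Ω N)) [∀ N, IsProbabilityMeasure (μ N)]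
    (P : ∀ N, Matrix (S N) (S N) ℝ) (p : ∀ N, S N → ℝ)
    (X : ∀ N, ℕ → Ω N → S N) (A : ∀ N, Set (S N))
    (hP : ∀ N, HaltingCutoff.IsStochastic (P N))
    (hirr : ∀ N, (P N).IsIrreducible)
    (hp : ∀ N, HaltingCutoff.IsStationary (P N) (p N))
    (hX : ∀ N, HaltingCutoff.IsMarkovChain (P N) (μ N) (X N))
    (hAne : ∀ N, (A N).Nonempty)
    (hA : ∀ N, HaltingCutoff.IsHaltingSet (μ N) (X N) (p N) (A N))
    (hσ : (fun N => HaltingCutoff.stdHit (μ N) (X N) (A N)) =o[atTop]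
      (fun N => HaltingCutoff.meanHit (μ N) (X N) (A N)))
    (hE : Tendsto (fun N => (1 - HaltingCutoff.topEigenvalue (P N) (A N)) *
      HaltingCutoff.meanHit (μ N) (X N) (A N)) atTop atTop) :
    HaltingCutoff.HasCutoff (fun N => HaltingCutoff.tvDist (μ N) (X N) (p N))
        (fun N => HaltingCutoff.meanHit (μ N) (X N) (A N)) ∧
      (0 < liminf (fun N => (((1 - HaltingCutoff.topEigenvalue (P N) (A N)) *
          HaltingCutoff.stdHit (μ N) (X N) (A N) : ℝ) : EReal)) atTop →
        HaltingCutoff.HasCutoffWindow (fun N => HaltingCutoff.tvDist (μ N) (X N) (p N))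
          (fun N => HaltingCutoff.meanHit (μ N) (X N) (A N))
          (fun N => HaltingCutoff.stdHit (μ N) (X N) (A N))) := by
  have hd0 : ∀ N n, 0 ≤ HaltingCutoff.tvDist (μ N) (X N) (p N) n :=
    fun N n => HaltingCutoff.tvDist_nonneg _ _ _ n
  have hd1 : ∀ N n, HaltingCutoff.tvDist (μ N) (X N) (p N) n ≤ 1 :=
    fun N n => (hA N).tvDist_le_one n
  have hup := fun N s (hs : 0 < s) => (hA N).tvDist_le (hX N) (hP N) (hirr N) (hAne N) hs
  have hlow := fun N y s (hy : 0 ≤ y) (hs : 0 < s) =>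
    HaltingCutoff.one_sub_le_tvDist (hX N) (hP N) (hirr N) (hAne N) (hp N) hy hs
  have hgap : ∀ N, 1 - HaltingCutoff.topEigenvalue (P N) (A N) ≤ 2 := fun N => by
    linarith [HaltingCutoff.neg_one_le_topEigenvalue (hP N) (A N)]
  have ht0 : ∀ N, 0 ≤ HaltingCutoff.meanHit (μ N) (X N) (A N) :=
    fun N => integral_nonneg fun ω => Nat.cast_nonneg _
  have ht : Tendsto (fun N => HaltingCutoff.meanHit (μ N) (X N) (A N)) atTop atTop :=
    (tendsto_const_mul_atTop_of_pos two_pos).1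
      (tendsto_atTop_mono (fun N => mul_le_mul_of_nonneg_right (hgap N) (ht0 N)) hE)
  refine ⟨HaltingCutoff.hasCutoff_of_bounds hd0 hd1 hup hlow hσ ht, fun hw => ?_⟩
  -- Eventually `c < (1 - λ) * w ≤ 2 * w`, whence the lower bound `c / 2` for `w`.
  obtain ⟨c, hc0, hc⟩ := EReal.lt_iff_exists_real_btwn.1 hw
  have hc0' : 0 < c := EReal.coe_pos.1 hc0
  refine HaltingCutoff.hasCutoffWindow_of_bounds hd0 hd1 hup hlow hσ ht (half_pos hc0') ?_
  filter_upwards [eventually_lt_of_lt_liminf hc] with N hN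
  have h1 := EReal.coe_lt_coe_iff.1 hN
  have h2 := mul_le_mul_of_nonneg_right (hgap N)
    (Real.sqrt_nonneg (variance (HaltingCutoff.realHittingTime (X N) (A N)) (μ N)))
  change _ ≤ 2 * HaltingCutoff.stdHit (μ N) (X N) (A N) at h2
  change _ * HaltingCutoff.stdHit (μ N) (X N) (A N) ≤ _ at h2
  linarith
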